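/- Let $\mathbb{F}_q$ be a finite field with $q$ elements, $\mathcal{R}=\mathbb{F}_q[x]$ and $\mathcal{K}=\mathbb{F}_q((x^{-1}))$, with absolute value $|f|=q^{-\nu(f)}$ for $f\neq 0$, where $\nu\left(\sum_i a_i x^{-i}\right)=\min\{i : a_i\neq 0\}$, and $|0|=0$. Equip $\mathcal{K}^n$ with $\|\mathbf{v}\|=\max_i |v_i|$. Nonzero vectors $\mathbf{u}_1,\dots,\mathbf{u}_k\in\mathcal{K}^n$ are orthogonal if $\|\sum_i c_i\mathbf{u}_i\|=\max_i\|c_i\mathbf{u}_i\|$ for all $c_1,\dots,c_k\in\mathcal{K}$. A $k$-sublattice of $\mathcal{K}^n$ is a subgroup of the form $\Lambda=\mathcal{R}\mathbf{v}_1\oplus\dots\oplus\mathcal{R}\mathbf{v}_k$ with $\mathbf{v}_1,\dots,\mathbf{v}_k\in\mathcal{K}^n$ linearly independent over $\mathcal{K}$. For $1\le i\le k$ its $i$-th successive minimum $\lambda_i(\Lambda)$ is the infimum of all $r>0$ such that $\Lambda$ contains $i$ $\mathcal{K}$-linearly independent vectors of norm at most $r$. Given $\mu_1<\dots<\mu_m$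 in $q^{\mathbb{Z}}$ and $\mathbf{s}=(s_1,\dots,s_m)\in\mathbb{N}^m$, a $k$-sublattice $\Lambda$ is a $(\boldsymbol{\mu},\mathbf{s})$-sublattice if $\{\lambda_1(\Lambda),\dots,\lambda_k(\Lambda)\}=\{\mu_1,\dots,\mu_m\}$ and $|\{1\le i\le k : \lambda_i(\Lambda)=\mu_j\}|=s_j$ for every $1\le j\le m$. An ordered orthogonal basis of $\Lambda$ is an $\mathcal{R}$-basis $(\mathbf{u}_1,\dots,\mathbf{u}_k)$ of $\Lambda$ whose vectors are orthogonal and satisfy $\|\mathbf{u}_1\|\le\dots\le\|\mathbf{u}_k\|$. **Theorem.** Let $1\le k\le n$ and let $\Lambda\le\mathcal{K}^n$ be a $(\boldsymbol{\mu},\mathbf{s})$-sublattice of dimension $k$. Then $\Lambda$ has only finitely many ordered orthogonal bases, and their number is $$\begin{cases}\displaystyle\prod_{i=0}^{k-1}(q^k-q^i) & \text{if } m=1,\\[2ex] \displaystyle q^{\sum_{\ell=1}^m s_\ell\sum_{j=1}^{\ell-1}s_j}\prod_{\ell=1}^m\left(\mu_\ell^{\,s_\ell\left(\sum_{i=1}^{\ell-1}s_i-\sum_{i=\ell+1}^m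 s_i\right)}\prod_{i=0}^{s_\ell-1}(q^{s_\ell}-q^i)\right) & \text{otherwise.}\end{cases}$$ -/

import Mathlib

open scoped LaurentSeries Polynomial

namespace FunctionFieldLattice

noncomputable section

/-- The ring homomorphism `F[x] → F((x⁻¹))`. The field `F((x⁻¹))` is the field `F⸨X⸩` of formal
Laurent series whose formal variable `X` plays the role of `x⁻¹`; thus `x` is sent to `X⁻¹`. -/
def polyHom (F : Type*) [Field F] : F[X] →+* F⸨X⸩ :=
  Polynomial.eval₂RingHom (HahnSeries.C : F →+* F⸨X⸩) (HahnSeries.single (-1 : ℤ) (1 : F))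

/-- The ring `𝓡 = F[x]`, as a subring of `F((x⁻¹))`. -/
def polyRing (F : Type*) [Field F] : Subring F⸨X⸩ := (polyHom F).range

/-- The absolute value `|f| = q ^ (-ν f)` on `F((x⁻¹))`, where `q = |F|` and `ν f` is the least
exponent of `x⁻¹` that occurs in `f`; and `|0| = 0`. -/
def absK {F : Type*} [Field F] [Fintype F] (f : F⸨X⸩) : ℝ :=
  open scoped Classical in
  if f = 0 then 0 else (Fintype.card F : ℝ) ^ (-HahnSeries.order f)

/-- The infinity norm `‖v‖ = max |v i|` on `F((x⁻¹))ⁿ`. -/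
def normK {F : Type*} [Field F] [Fintype F] {n : ℕ} (v : Fin n → F⸨X⸩) : ℝ :=
  ⨆ i, absK (v i)

/-- Ultrametric orthogonality of a tuple of nonzero vectors. -/
def IsOrthogonal {F : Type*} [Field F] [Fintype F] {n k : ℕ}
    (u : Fin k → (Fin n → F⸨X⸩)) : Prop :=
  (∀ i, u i ≠ 0) ∧
    ∀ c : Fin k → F⸨X⸩, normK (∑ i, c i • u i) = ⨆ i, normK (c i • u i)

/-- `Λ` is a `k`-sublattice: `Λ = 𝓡 v₁ ⊕ ⋯ ⊕ 𝓡 vₖ` for some vectors `v₁, …, vₖ` that are linearly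
independent over `F((x⁻¹))`. -/
def IsSublattice {F : Type*} [Field F] {n : ℕ} (k : ℕ)
    (Λ : AddSubgroup (Fin n → F⸨X⸩)) : Prop :=
  ∃ v : Fin k → (Fin n → F⸨X⸩), LinearIndependent F⸨X⸩ v ∧
    Λ = (Submodule.span (polyRing F) (Set.range v)).toAddSubgroup

/-- The `i`-th successive minimum (`1 ≤ i`): the infimum of the `r > 0` for which `Λ` contains `i`
linearly independent vectors of norm at most `r`. -/
def succMin {F : Type*} [Field F] [Fintype F] {n : ℕ}
    (Λ : AddSubgroup (Fin n → F⸨X⸩)) (i : ℕ) : ℝ :=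
  sInf {r : ℝ | 0 < r ∧ ∃ w : Fin i → (Fin n → F⸨X⸩), LinearIndependent F⸨X⸩ w ∧
    ∀ j, w j ∈ Λ ∧ normK (w j) ≤ r}

/-- `Λ` is a `(μ, s)`-sublattice of dimension `k`: a `k`-sublattice whose distinct successive minima
are `μ₁ < ⋯ < μₘ`, with `μⱼ ∈ q^ℤ` occurring exactly `sⱼ` times. -/
structure IsMuSSublattice {F : Type*} [Field F] [Fintype F] {n m : ℕ} (k : ℕ)
    (μ : Fin m → ℝ) (s : Fin m → ℕ) (Λ : AddSubgroup (Fin n → F⸨X⸩)) : Prop where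
  isSublattice : IsSublattice k Λ
  mem_zpow : ∀ j, ∃ z : ℤ, μ j = (Fintype.card F : ℝ) ^ z
  strictMono : StrictMono μ
  minima_eq : succMin Λ '' Set.Icc 1 k = Set.range μ
  mult_eq : ∀ j, {i ∈ Set.Icc 1 k | succMin Λ i = μ j}.ncard = s j

/-- The tuple `u` is an `𝓡`-basis of `Λ`. -/
def IsRBasis {F : Type*} [Field F] {n k : ℕ} (Λ : AddSubgroup (Fin n → F⸨X⸩))
    (u : Fin k → (Fin n → F⸨X⸩)) : Prop :=
  LinearIndependent (polyRing F) u ∧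
    Λ = (Submodule.span (polyRing F) (Set.range u)).toAddSubgroup

/-- The set of ordered orthogonal `𝓡`-bases `(u₁, …, uₖ)` of `Λ`, ordered meaning
`‖u₁‖ ≤ ⋯ ≤ ‖uₖ‖`. -/
def orderedOrthogonalBases {F : Type*} [Field F] [Fintype F] {n : ℕ} (k : ℕ)
    (Λ : AddSubgroup (Fin n → F⸨X⸩)) : Set (Fin k → (Fin n → F⸨X⸩)) :=
  {u | IsRBasis Λ u ∧ IsOrthogonal u ∧ Monotone fun i => normK (u i)}

end

end FunctionFieldLattice

/-!
Call a sequence `v 0, …, v (j - 1)` in `Λ` *minimal* if each `v i` has least norm among the vectors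
of `Λ` outside the `F((x⁻¹))`-span of its predecessors (`IsMinSeq`). The norms of a minimal sequence
are the successive minima of `Λ` (`IsMinSeq.succMin_eq`). Every vector of `Λ` in its span is a
combination with polynomial coefficients, and its members are orthogonal, because a failure of
either property would, after the coefficients are replaced by their fractional or polynomial parts,
exhibit a shorter vector outside the span of the predecessors (`IsMinSeq.exists_polyHom_eq`,
`IsMinSeq.normK_smul_le_normK_sum`). Conversely an ordered orthogonal basis is minimal, so the
ordered orthogonal bases of `Λ` are its minimal sequences of length `k`
(`IsSublattice.mem_orderedOrthogonalBases_iff`). They exist because a sublattice is discrete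
(`IsSublattice.exists_pos_le_normK`).

Minimal sequences are counted one vector at a time. Let `q ^ d 0 ≤ q ^ d 1 ≤ ⋯` be the successive
minima. A minimal sequence of length `l` is prolonged exactly by the vectors of `Λ` of norm at most
`q ^ d l` that do not lie in its span. By orthogonality, a ball of radius `q ^ d l` in the part of
`Λ` spanned by a minimal sequence of length `j` has `∏ i < j, q ^ max 0 (d l - d i + 1)` elements
(`IsMinSeq.finite_ncard_ball`), so the number of prolongations is this expression for `j = k` minus
that for `j = l`, whatever the sequence. Grouping the indices by the value of `d` turns the product
of these numbers into the stated formula (`prod_sub_prod_eq`).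
-/

namespace FunctionFieldLattice

/-! ### The absolute value on `F((x⁻¹))` -/

section Absolute

variable {F : Type*} [Field F] [Fintype F]

theorem one_lt_card_real : (1 : ℝ) < Fintype.card F := by
  exact_mod_cast Fintype.one_lt_card

theorem card_real_pos : (0 : ℝ) < Fintype.card F :=
  zero_lt_one.trans one_lt_card_real

theorem absK_zero : absK (0 : F⸨X⸩) = 0 := by simp [absK]

theorem absK_of_ne_zero {f : F⸨X⸩} (hf : f ≠ 0) :
    absK f = (Fintype.card F : ℝ) ^ (-HahnSeries.order f) := by simp [absK, hf]

theorem absK_pos {f : F⸨X⸩} (hf : f ≠ 0) : 0 < absK f := by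
  rw [absK_of_ne_zero hf]; exact zpow_pos card_real_pos _

theorem absK_nonneg (f : F⸨X⸩) : 0 ≤ absK f := by
  by_cases hf : f = 0
  · simp [hf, absK_zero]
  · exact (absK_pos hf).le

theorem absK_one : absK (1 : F⸨X⸩) = 1 := by
  rw [absK_of_ne_zero one_ne_zero]; simp

theorem absK_mul (f g : F⸨X⸩) : absK (f * g) = absK f * absK g := by
  by_cases hf : f = 0
  · simp [hf, absK_zero]
  by_cases hg : g = 0
  · simp [hg, absK_zero]
  rw [absK_of_ne_zero hf, absK_of_ne_zero hg, absK_of_ne_zero (mul_ne_zero hf hg),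
    HahnSeries.order_mul hf hg, neg_add, zpow_add₀ card_real_pos.ne']

theorem absK_le_zpow_iff {f : F⸨X⸩} {z : ℤ} :
    absK f ≤ (Fintype.card F : ℝ) ^ z ↔ ∀ i < -z, f.coeff i = 0 := by
  by_cases hf : f = 0
  · simp [hf, absK_zero, (zpow_pos card_real_pos z).le]
  rw [absK_of_ne_zero hf, zpow_le_zpow_iff_right₀ one_lt_card_real]
  constructor
  · intro h i hi
    exact HahnSeries.coeff_eq_zero_of_lt_order (by omega)
  · intro h
    by_contra! hlt
    exact hf (HahnSeries.coeff_order_eq_zero.1 (h _ (by omega)))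

theorem absK_add_le (f g : F⸨X⸩) : absK (f + g) ≤ max (absK f) (absK g) := by
  by_cases hf : f = 0
  · simp [hf, absK_zero, absK_nonneg]
  by_cases hg : g = 0
  · simp [hg, absK_zero, absK_nonneg]
  wlog h : absK f ≤ absK g generalizing f g
  · rw [add_comm, max_comm]; exact this g f hg hf (not_le.1 h).le
  rw [max_eq_right h]
  rw [absK_of_ne_zero hg, absK_le_zpow_iff] at h ⊢
  intro i hi
  rw [HahnSeries.coeff_add, h i hi, HahnSeries.coeff_eq_zero_of_lt_order (by simpa using hi),
    add_zero]

theorem absK_lt_one_iff {f : F⸨X⸩} : absK f < 1 ↔ ∀ i ≤ 0, f.coeff i = 0 := by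
  have h : absK f < 1 ↔ absK f ≤ (Fintype.card F : ℝ) ^ (-1 : ℤ) := by
    by_cases hf : f = 0
    · simp [hf, absK_zero]
    · rw [absK_of_ne_zero hf, zpow_le_zpow_iff_right₀ one_lt_card_real,
        zpow_lt_one_iff_right₀ one_lt_card_real]
      omega
  rw [h, absK_le_zpow_iff]
  exact forall_congr' fun i => imp_congr_left (by omega)

end Absolute

/-! ### Polynomials in `F((x⁻¹))` -/

section Poly

variable {F : Type*} [Field F]

theorem polyHom_monomial (a : F) (j : ℕ) :
    polyHom F (Polynomial.monomial j a) = HahnSeries.single (-(j : ℤ)) a := by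
  simp [polyHom, Polynomial.eval₂_monomial, HahnSeries.C_apply]

/-- The polynomial coefficient of `x ^ j` is the Laurent coefficient of `(x⁻¹) ^ (-j)`. -/
theorem coeff_polyHom_neg (p : F[X]) (j : ℕ) : (polyHom F p).coeff (-(j : ℤ)) = p.coeff j := by
  induction p using Polynomial.induction_on' with
  | add p r hp hr => simp [hp, hr]
  | monomial i a =>
    rw [polyHom_monomial, HahnSeries.coeff_single, Polynomial.coeff_monomial]
    simp [eq_comm]

theorem coeff_polyHom_of_pos (p : F[X]) {i : ℤ} (hi : 0 < i) : (polyHom F p).coeff i = 0 := by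
  induction p using Polynomial.induction_on' with
  | add p r hp hr => simp [hp, hr]
  | monomial j a =>
    rw [polyHom_monomial, HahnSeries.coeff_single, if_neg (by omega)]

theorem polyHom_injective : Function.Injective (polyHom F) := by
  intro p r h
  ext j
  rw [← coeff_polyHom_neg, ← coeff_polyHom_neg, h]

theorem mem_polyRing {f : F⸨X⸩} : f ∈ polyRing F ↔ ∃ p, polyHom F p = f := Iff.rfl

variable [Fintype F]

theorem one_le_absK_polyHom {p : F[X]} (hp : p ≠ 0) : 1 ≤ absK (polyHom F p) := by
  by_contra! h
  rw [absK_lt_one_iff] at h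
  exact hp (Polynomial.ext fun j => by rw [← coeff_polyHom_neg, h _ (by omega)]; simp)

theorem absK_polyHom_le_iff {p : F[X]} {z : ℤ} :
    absK (polyHom F p) ≤ (Fintype.card F : ℝ) ^ z ↔ p ∈ Polynomial.degreeLT F (z + 1).toNat := by
  rw [absK_le_zpow_iff, Polynomial.mem_degreeLT, Polynomial.degree_lt_iff_coeff_zero]
  constructor
  · intro h j hj
    rw [← coeff_polyHom_neg]
    exact h _ (by omega)
  · intro h i hi
    obtain hi0 | hi0 := lt_or_ge 0 i
    · exact coeff_polyHom_of_pos p hi0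
    · obtain ⟨j, hj⟩ := Int.eq_ofNat_of_zero_le (neg_nonneg.2 hi0)
      obtain rfl : i = -(j : ℤ) := by omega
      rw [coeff_polyHom_neg]
      exact h j (by omega)

/-- Every element of `F((x⁻¹))` is a polynomial plus a fractional part of absolute value less
than one. -/
theorem exists_absK_sub_polyHom_lt_one (f : F⸨X⸩) : ∃ p : F[X], absK (f - polyHom F p) < 1 := by
  classical
  refine ⟨∑ j ∈ Finset.range ((-f.order).toNat + 1), Polynomial.monomial j (f.coeff (-(j : ℤ))),
    absK_lt_one_iff.2 fun i hi => ?_⟩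
  obtain ⟨j, hj⟩ := Int.eq_ofNat_of_zero_le (neg_nonneg.2 hi)
  obtain rfl : i = -(j : ℤ) := by omega
  rw [HahnSeries.coeff_sub, coeff_polyHom_neg, Polynomial.finsetSum_coeff]
  simp only [Polynomial.coeff_monomial, Finset.sum_ite_eq', Finset.mem_range]
  split_ifs with h
  · exact sub_self _
  · rw [HahnSeries.coeff_eq_zero_of_lt_order (by omega), sub_zero]

theorem natCard_degreeLT (r : ℕ) : Nat.card (Polynomial.degreeLT F r) = Fintype.card F ^ r := by
  rw [Nat.card_congr (Polynomial.degreeLTEquiv F r).toEquiv]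
  simp

theorem finite_degreeLT (r : ℕ) : Finite (Polynomial.degreeLT F r) :=
  Finite.of_equiv _ (Polynomial.degreeLTEquiv F r).toEquiv.symm

end Poly

/-! ### The maximum norm -/

section Norm

variable {F : Type*} [Field F] [Fintype F] {n : ℕ}

theorem normK_nonneg (v : Fin n → F⸨X⸩) : 0 ≤ normK v :=
  Real.iSup_nonneg fun _ => absK_nonneg _

theorem absK_le_normK (v : Fin n → F⸨X⸩) (i : Fin n) : absK (v i) ≤ normK v :=
  le_ciSup (f := fun i => absK (v i)) (Set.finite_range _).bddAbove i

theorem normK_le_iff {v : Fin n → F⸨X⸩} {r : ℝ} (hr : 0 ≤ r) :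
    normK v ≤ r ↔ ∀ i, absK (v i) ≤ r :=
  ⟨fun h i => (absK_le_normK v i).trans h, fun h => Real.iSup_le h hr⟩

theorem normK_zero : normK (0 : Fin n → F⸨X⸩) = 0 :=
  le_antisymm ((normK_le_iff le_rfl).2 fun _ => by simp [absK_zero]) (normK_nonneg _)

theorem normK_pos {v : Fin n → F⸨X⸩} (hv : v ≠ 0) : 0 < normK v := by
  obtain ⟨i, hi⟩ := Function.ne_iff.1 hv
  exact (absK_pos hi).trans_le (absK_le_normK v i)

theorem normK_smul (c : F⸨X⸩) (v : Fin n → F⸨X⸩) : normK (c • v) = absK c * normK v := by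
  simp only [normK, Pi.smul_apply, smul_eq_mul, absK_mul]
  exact (Real.mul_iSup_of_nonneg (absK_nonneg c) _).symm

theorem normK_add_le (v w : Fin n → F⸨X⸩) : normK (v + w) ≤ max (normK v) (normK w) :=
  (normK_le_iff (le_max_of_le_left (normK_nonneg v))).2 fun i =>
    (absK_add_le _ _).trans (max_le_max (absK_le_normK v i) (absK_le_normK w i))

theorem normK_neg (v : Fin n → F⸨X⸩) : normK (-v) = normK v := by
  have h : absK (-1 : F⸨X⸩) = 1 := by
    have := absK_mul (-1 : F⸨X⸩) (-1)
    rw [neg_mul_neg, one_mul, absK_one] at this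
    nlinarith [absK_nonneg (-1 : F⸨X⸩)]
  rw [← neg_one_smul F⸨X⸩ v, normK_smul, h, one_mul]

theorem normK_sum_le {ι : Type*} (t : Finset ι) (f : ι → Fin n → F⸨X⸩) {r : ℝ} (hr : 0 ≤ r)
    (h : ∀ i ∈ t, normK (f i) ≤ r) : normK (∑ i ∈ t, f i) ≤ r := by
  classical
  induction t using Finset.induction_on with
  | empty => simpa [normK_zero] using hr
  | insert a t ha ih =>
    rw [Finset.sum_insert ha]
    exact (normK_add_le _ _).trans (max_le (h a (by simp)) (ih fun i hi => h i (by simp [hi])))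

theorem normK_sum_lt {ι : Type*} (t : Finset ι) (f : ι → Fin n → F⸨X⸩) {r : ℝ} (hr : 0 < r)
    (h : ∀ i ∈ t, normK (f i) < r) : normK (∑ i ∈ t, f i) < r := by
  classical
  induction t using Finset.induction_on with
  | empty => simpa [normK_zero] using hr
  | insert a t ha ih =>
    rw [Finset.sum_insert ha]
    exact (normK_add_le _ _).trans_lt
      (max_lt (h a (by simp)) (ih fun i hi => h i (by simp [hi])))

theorem exists_normK_eq_zpow {v : Fin n → F⸨X⸩} (hv : v ≠ 0) :
    ∃ z : ℤ, normK v = (Fintype.card F : ℝ) ^ z := by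
  obtain ⟨i₀, -⟩ := Function.ne_iff.1 hv
  have : Nonempty (Fin n) := ⟨i₀⟩
  obtain ⟨i, hi⟩ := exists_eq_ciSup_of_finite (f := fun i => absK (v i))
  have hi' : absK (v i) = normK v := hi
  have h0 : v i ≠ 0 := by
    intro h
    have := normK_pos hv
    rw [← hi', h, absK_zero] at this
    exact this.false
  exact ⟨_, by rw [← hi', absK_of_ne_zero h0]⟩

end Norm

/-! ### Minimal sequences -/

section MinSeq

variable {F : Type*} [Field F] {n j : ℕ}

theorem exists_last_ne_zero {c : Fin j → F⸨X⸩} (hc : c ≠ 0) :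
    ∃ l, c l ≠ 0 ∧ ∀ i, l < i → c i = 0 := by
  classical
  obtain ⟨i, hi⟩ := Function.ne_iff.1 hc
  obtain ⟨l, hl, hmax⟩ := (Finset.univ.filter fun i => c i ≠ 0).exists_max_image id
    ⟨i, by simpa using hi⟩
  refine ⟨l, by simpa using hl, fun i hi => ?_⟩
  by_contra h
  exact (hmax i (by simpa using h)).not_gt hi

theorem sum_notMem_span {v : Fin j → Fin n → F⸨X⸩} {c : Fin j → F⸨X⸩} {l : Fin j}
    (hv : v l ∉ Submodule.span F⸨X⸩ (v '' Set.Iio l)) (hl : c l ≠ 0)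
    (hc : ∀ i, l < i → c i = 0) :
    ∑ i, c i • v i ∉ Submodule.span F⸨X⸩ (v '' Set.Iio l) := by
  classical
  intro hmem
  rw [← Finset.add_sum_erase _ _ (Finset.mem_univ l)] at hmem
  have hrest : ∑ i ∈ Finset.univ.erase l, c i • v i ∈ Submodule.span F⸨X⸩ (v '' Set.Iio l) := by
    refine Submodule.sum_mem _ fun i hi => ?_
    obtain h | h := lt_or_gt_of_ne (Finset.ne_of_mem_erase hi)
    · exact Submodule.smul_mem _ _ (Submodule.subset_span ⟨i, h, rfl⟩)
    · simp [hc i h]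
  have := (Submodule.add_mem_iff_left _ hrest).1 hmem
  exact hv ((Submodule.smul_mem_iff _ hl).1 this)

theorem linearIndependent_of_notMem_span {v : Fin j → Fin n → F⸨X⸩}
    (hv : ∀ l, v l ∉ Submodule.span F⸨X⸩ (v '' Set.Iio l)) : LinearIndependent F⸨X⸩ v := by
  rw [Fintype.linearIndependent_iff]
  intro c hc
  by_contra! h
  obtain ⟨l, hl, hlast⟩ := exists_last_ne_zero (c := c) fun h0 => by simp [h0] at h
  exact sum_notMem_span (hv l) hl hlast (hc ▸ Submodule.zero_mem _)

variable [Fintype F]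

/-- A sequence chosen greedily in `Λ`: each `v i` is a vector of `Λ` of least norm outside the
`F((x⁻¹))`-span of its predecessors. -/
structure IsMinSeq (Λ : AddSubgroup (Fin n → F⸨X⸩)) (v : Fin j → Fin n → F⸨X⸩) : Prop where
  mem : ∀ i, v i ∈ Λ
  notMem : ∀ i, v i ∉ Submodule.span F⸨X⸩ (v '' Set.Iio i)
  le : ∀ i, ∀ w ∈ Λ, w ∉ Submodule.span F⸨X⸩ (v '' Set.Iio i) → normK (v i) ≤ normK w

namespace IsMinSeq

variable {Λ : AddSubgroup (Fin n → F⸨X⸩)} {v : Fin j → Fin n → F⸨X⸩}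

theorem linearIndependent (hv : IsMinSeq Λ v) : LinearIndependent F⸨X⸩ v :=
  linearIndependent_of_notMem_span hv.notMem

theorem ne_zero (hv : IsMinSeq Λ v) (i : Fin j) : v i ≠ 0 := hv.linearIndependent.ne_zero i

theorem monotone (hv : IsMinSeq Λ v) : Monotone fun i => normK (v i) := fun i i' h =>
  hv.le i _ (hv.mem i') fun hmem => hv.notMem i'
    (Submodule.span_mono (Set.image_mono (Set.Iio_subset_Iio h)) hmem)

/-- The polynomial combinations of a minimal sequence exhaust the part of `Λ` in its span: otherwise
the fractional parts of the coefficients would give a vector of `Λ` that is too short. -/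
theorem exists_polyHom_eq (hv : IsMinSeq Λ v) (hΛ : ∀ p : F[X], ∀ w ∈ Λ, polyHom F p • w ∈ Λ)
    {c : Fin j → F⸨X⸩} (hc : ∑ i, c i • v i ∈ Λ) :
    ∃ p : Fin j → F[X], ∀ i, c i = polyHom F (p i) := by
  choose p hp using fun i => exists_absK_sub_polyHom_lt_one (c i)
  refine ⟨p, fun i => sub_eq_zero.1 ?_⟩
  by_contra hi
  obtain ⟨l, hl, hlast⟩ := exists_last_ne_zero (c := fun i => c i - polyHom F (p i))
    fun h => hi (congrFun h i)
  have hmem : ∑ i, (c i - polyHom F (p i)) • v i ∈ Λ := by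
    simp only [sub_smul, Finset.sum_sub_distrib]
    exact Λ.sub_mem hc (Λ.sum_mem fun i _ => hΛ _ _ (hv.mem i))
  refine (hv.le l _ hmem (sum_notMem_span (hv.notMem l) hl hlast)).not_gt ?_
  refine normK_sum_lt _ _ (normK_pos (hv.ne_zero l)) fun i _ => ?_
  rw [normK_smul]
  obtain h | h := lt_or_ge l i
  · rw [hlast i h, absK_zero, zero_mul]
    exact normK_pos (hv.ne_zero l)
  · exact (mul_lt_of_lt_one_left (normK_pos (hv.ne_zero i)) (hp i)).trans_le (hv.monotone h)

/-- If the terms of largest norm cancelled, then replacing their coefficients by polynomial parts,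
after the last of them is scaled to one, would give a vector of `Λ` that is too short. -/
theorem normK_smul_le_normK_sum (hv : IsMinSeq Λ v)
    (hΛ : ∀ p : F[X], ∀ w ∈ Λ, polyHom F p • w ∈ Λ) (c : Fin j → F⸨X⸩) (i₀ : Fin j) :
    normK (c i₀ • v i₀) ≤ normK (∑ i, c i • v i) := by
  classical
  by_contra! hlt
  obtain ⟨l₀, -, hl₀⟩ := Finset.univ.exists_max_image (fun i => normK (c i • v i)) ⟨i₀, by simp⟩
  obtain ⟨l, hl, hlast⟩ := (Finset.univ.filter fun i =>
    normK (c i • v i) = normK (c l₀ • v l₀)).exists_max_image id ⟨l₀, by simp⟩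
  replace hl : normK (c l • v l) = normK (c l₀ • v l₀) := by simpa using hl
  have hmax : ∀ i, normK (c i • v i) ≤ normK (c l • v l) := fun i => hl ▸ hl₀ i (by simp)
  -- `l` is the last index at which the largest norm is attained
  have hstrict : ∀ i, l < i → normK (c i • v i) < normK (c l • v l) := fun i hi =>
    (hmax i).lt_of_ne fun h => (hlast i (by simpa using h.trans hl)).not_gt hi
  have hsum : normK (∑ i, c i • v i) < normK (c l • v l) := hlt.trans_le (hmax i₀)
  have hcl : c l ≠ 0 := by
    intro h
    rw [h, zero_smul, normK_zero] at hsum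
    exact (normK_nonneg _).not_gt hsum
  have hcl' : 0 < absK (c l)⁻¹ := absK_pos (inv_ne_zero hcl)
  have hone : absK (c l)⁻¹ * normK (c l • v l) = normK (v l) := by
    rw [← normK_smul, inv_smul_smul₀ hcl]
  have happrox : ∀ i, ∃ p : F[X], normK (((c l)⁻¹ * c i - polyHom F p) • v i) < normK (v l) ∧
      (i = l → p = 1) ∧ (l < i → p = 0) := by
    intro i
    by_cases hil : i = l
    · subst hil
      refine ⟨1, ?_, fun _ => rfl, fun h => (h.false).elim⟩
      rw [inv_mul_cancel₀ hcl, map_one, sub_self, zero_smul, normK_zero]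
      exact normK_pos (hv.ne_zero i)
    by_cases hi : l < i
    · refine ⟨0, ?_, fun h => (hil h).elim, fun _ => rfl⟩
      rw [map_zero, sub_zero, mul_smul, normK_smul, ← hone]
      exact mul_lt_mul_of_pos_left (hstrict i hi) hcl'
    · obtain ⟨p, hp⟩ := exists_absK_sub_polyHom_lt_one ((c l)⁻¹ * c i)
      refine ⟨p, ?_, fun h => (hil h).elim, fun h => (hi h).elim⟩
      rw [normK_smul]
      exact (mul_lt_of_lt_one_left (normK_pos (hv.ne_zero i)) hp).trans_le
        (hv.monotone (not_lt.1 hi))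
  choose p hp hp1 hp0 using happrox
  refine (hv.le l (∑ i, polyHom F (p i) • v i) (Λ.sum_mem fun i _ => hΛ _ _ (hv.mem i))
    (sum_notMem_span (hv.notMem l) (by simp [hp1 l rfl]) fun i hi => by simp [hp0 i hi])).not_gt ?_
  have hsplit : ∑ i, polyHom F (p i) • v i =
      (c l)⁻¹ • ∑ i, c i • v i + -∑ i, ((c l)⁻¹ * c i - polyHom F (p i)) • v i := by
    rw [Finset.smul_sum, ← Finset.sum_neg_distrib, ← Finset.sum_add_distrib]
    refine Finset.sum_congr rfl fun i _ => ?_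
    rw [sub_smul, mul_smul]
    abel
  rw [hsplit]
  refine (normK_add_le _ _).trans_lt (max_lt ?_ ?_)
  · rw [normK_smul, ← hone]
    exact mul_lt_mul_of_pos_left hsum hcl'
  · rw [normK_neg]
    exact normK_sum_lt _ _ (normK_pos (hv.ne_zero l)) fun i _ => hp i

theorem isOrthogonal (hv : IsMinSeq Λ v) (hΛ : ∀ p : F[X], ∀ w ∈ Λ, polyHom F p • w ∈ Λ) :
    IsOrthogonal v :=
  ⟨hv.ne_zero, fun c => le_antisymm
    (normK_sum_le _ _ (Real.iSup_nonneg fun _ => normK_nonneg _) fun i _ =>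
      le_ciSup (f := fun i => normK (c i • v i)) (Set.finite_range _).bddAbove i)
    (Real.iSup_le (hv.normK_smul_le_normK_sum hΛ c) (normK_nonneg _))⟩

/-- Among `i + 1` independent vectors of `Λ`, one lies outside the span of `v 0, …, v (i - 1)`. -/
theorem succMin_eq (hv : IsMinSeq Λ v) (i : Fin j) : succMin Λ (i + 1) = normK (v i) := by
  refine IsLeast.csInf_eq ⟨⟨normK_pos (hv.ne_zero i), fun a => v (Fin.castLE i.2 a),
    hv.linearIndependent.comp _ (Fin.castLE_injective _), fun a =>
    ⟨hv.mem _, hv.monotone (Fin.le_def.2 (Nat.lt_succ_iff.1 a.2))⟩⟩, ?_⟩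
  rintro r ⟨-, w, hw, hwr⟩
  obtain ⟨a, ha⟩ : ∃ a, w a ∉ Submodule.span F⸨X⸩ (v '' Set.Iio i) := by
    classical
    by_contra! h
    -- otherwise `i + 1` independent vectors would lie in a span of dimension at most `i`
    have hle := Submodule.finrank_mono (Submodule.span_le.2 (Set.range_subset_iff.2 h))
    have hcard := finrank_span_finset_le_card (R := F⸨X⸩) ((Finset.Iio i).image v)
    rw [Finset.coe_image, Finset.coe_Iio] at hcard
    rw [finrank_span_eq_card hw, Fintype.card_fin] at hle
    have := (hle.trans hcard).trans Finset.card_image_le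
    rw [Fin.card_Iio] at this
    omega
  exact (hv.le i _ (hwr a).1 ha).trans (hwr a).2

end IsMinSeq

/-- Splitting off the last vector of a minimal sequence. -/
theorem isMinSeq_snoc {Λ : AddSubgroup (Fin n → F⸨X⸩)} {v : Fin j → Fin n → F⸨X⸩}
    {w : Fin n → F⸨X⸩} :
    IsMinSeq Λ (Fin.snoc v w : Fin (j + 1) → Fin n → F⸨X⸩) ↔
      IsMinSeq Λ v ∧ w ∈ Λ ∧ w ∉ Submodule.span F⸨X⸩ (Set.range v) ∧
        ∀ w' ∈ Λ, w' ∉ Submodule.span F⸨X⸩ (Set.range v) → normK w ≤ normK w' := by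
  have hcast : ∀ i : Fin j, (Fin.snoc v w : Fin (j + 1) → Fin n → F⸨X⸩) '' Set.Iio i.castSucc =
      v '' Set.Iio i := by
    intro i
    ext y
    constructor
    · rintro ⟨a, ha, rfl⟩
      have ha' : (a : ℕ) < i := ha
      obtain ⟨b, rfl⟩ : ∃ b : Fin j, b.castSucc = a := ⟨⟨a, by omega⟩, rfl⟩
      exact ⟨b, ha, by simp⟩
    · rintro ⟨a, ha, rfl⟩
      exact ⟨a.castSucc, ha, by simp⟩
  have hlast : (Fin.snoc v w : Fin (j + 1) → Fin n → F⸨X⸩) '' Set.Iio (Fin.last j) =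
      Set.range v := by
    ext y
    constructor
    · rintro ⟨a, ha, rfl⟩
      obtain ⟨b, rfl⟩ : ∃ b : Fin j, b.castSucc = a := ⟨⟨a, ha⟩, rfl⟩
      exact ⟨b, by simp⟩
    · rintro ⟨a, rfl⟩
      exact ⟨a.castSucc, Fin.castSucc_lt_last a, by simp⟩
  constructor
  · intro h
    refine ⟨⟨fun i => ?_, fun i => ?_, fun i => ?_⟩, ?_, ?_, ?_⟩
    · simpa using h.mem i.castSucc
    · simpa [hcast] using h.notMem i.castSucc
    · simpa [hcast] using h.le i.castSucc
    · simpa using h.mem (Fin.last j)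
    · simpa [hlast] using h.notMem (Fin.last j)
    · simpa [hlast] using h.le (Fin.last j)
  · rintro ⟨hv, hw, hnot, hmin⟩
    refine ⟨fun i => ?_, fun i => ?_, fun i => ?_⟩ <;> induction i using Fin.lastCases
    · simpa using hw
    · simpa using hv.mem _
    · simpa [hlast] using hnot
    · simpa [hcast] using hv.notMem _
    · simpa [hlast] using hmin
    · simpa [hcast] using hv.le _

end MinSeq

/-! ### Sublattices and their ordered orthogonal bases -/

section Lattice

variable {F : Type*} [Field F] {n j k : ℕ} {Λ : AddSubgroup (Fin n → F⸨X⸩)}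

theorem mem_span_polyRing {v : Fin k → Fin n → F⸨X⸩} {w : Fin n → F⸨X⸩} :
    w ∈ (Submodule.span (polyRing F) (Set.range v)).toAddSubgroup ↔
      ∃ p : Fin k → F[X], ∑ i, polyHom F (p i) • v i = w := by
  rw [Submodule.mem_toAddSubgroup, Submodule.mem_span_range_iff_exists_fun]
  constructor
  · rintro ⟨c, rfl⟩
    choose p hp using fun i => mem_polyRing.1 (c i).2
    exact ⟨p, Finset.sum_congr rfl fun i _ => by rw [hp]; rfl⟩
  · rintro ⟨p, rfl⟩
    exact ⟨fun i => ⟨polyHom F (p i), p i, rfl⟩, rfl⟩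

namespace IsSublattice

theorem polyHom_smul_mem (h : IsSublattice k Λ) (p : F[X]) {w : Fin n → F⸨X⸩} (hw : w ∈ Λ) :
    polyHom F p • w ∈ Λ := by
  obtain ⟨v, -, rfl⟩ := h
  obtain ⟨c, rfl⟩ := mem_span_polyRing.1 hw
  exact mem_span_polyRing.2 ⟨fun i => p * c i, by
    simp [Finset.smul_sum, map_mul, mul_smul]⟩

theorem exists_notMem_span (h : IsSublattice k Λ) (v : Fin j → Fin n → F⸨X⸩) (hj : j < k) :
    ∃ w ∈ Λ, w ∉ Submodule.span F⸨X⸩ (Set.range v) := by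
  obtain ⟨u, hu, rfl⟩ := h
  by_contra! hcon
  have hle : Submodule.span F⸨X⸩ (Set.range u) ≤ Submodule.span F⸨X⸩ (Set.range v) :=
    Submodule.span_le.2 (Set.range_subset_iff.2 fun i => hcon _ (Submodule.subset_span ⟨i, rfl⟩))
  have hrank := Submodule.finrank_mono hle
  rw [finrank_span_eq_card hu, Fintype.card_fin] at hrank
  have := hrank.trans (finrank_range_le_card (R := F⸨X⸩) v)
  rw [Fintype.card_fin] at this
  omega

theorem mem_span_of_linearIndependent (h : IsSublattice k Λ) {v : Fin k → Fin n → F⸨X⸩}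
    (hv : LinearIndependent F⸨X⸩ v) (hmem : ∀ i, v i ∈ Λ) {w : Fin n → F⸨X⸩} (hw : w ∈ Λ) :
    w ∈ Submodule.span F⸨X⸩ (Set.range v) := by
  obtain ⟨u, hu, rfl⟩ := h
  have hsub : ∀ y ∈ (Submodule.span (polyRing F) (Set.range u)).toAddSubgroup,
      y ∈ Submodule.span F⸨X⸩ (Set.range u) := by
    intro y hy
    obtain ⟨p, rfl⟩ := mem_span_polyRing.1 hy
    exact Submodule.sum_mem _ fun i _ => Submodule.smul_mem _ _ (Submodule.subset_span ⟨i, rfl⟩)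
  have heq := Submodule.eq_of_le_of_finrank_eq
    (Submodule.span_le.2 (Set.range_subset_iff.2 fun i => hsub _ (hmem i)))
    (by rw [finrank_span_eq_card hv, finrank_span_eq_card hu])
  rw [heq]
  exact hsub _ hw

variable [Fintype F]

/-- A sublattice is discrete: the coordinates with respect to a basis are bounded by a multiple of
the norm, while a nonzero polynomial has absolute value at least one. -/
theorem exists_pos_le_normK (h : IsSublattice k Λ) :
    ∃ r : ℝ, 0 < r ∧ ∀ w ∈ Λ, w ≠ 0 → r ≤ normK w := by
  classical
  obtain ⟨u, hu, rfl⟩ := h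
  obtain ⟨g, hg⟩ := (Fintype.linearCombination F⸨X⸩ u).exists_leftInverse_of_injective
    (LinearMap.ker_eq_bot.2 (linearIndependent_iff_injective_fintypeLinearCombination.1 hu))
  set e : Fin n → Fin n → F⸨X⸩ := fun a b => if a = b then 1 else 0
  set C : ℝ := ∑ a, normK (g (e a)) + 1
  have hC : 0 < C := add_pos_of_nonneg_of_pos (Finset.sum_nonneg fun _ _ => normK_nonneg _) one_pos
  have hbound : ∀ w, normK (g w) ≤ C * normK w := by
    intro w
    rw [LinearMap.pi_apply_eq_sum_univ g w]
    refine normK_sum_le _ _ (mul_nonneg hC.le (normK_nonneg _)) fun a _ => ?_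
    rw [normK_smul, mul_comm]
    refine mul_le_mul ?_ (absK_le_normK w a) (absK_nonneg _) hC.le
    have := Finset.single_le_sum (f := fun a => normK (g (e a))) (fun _ _ => normK_nonneg _)
      (Finset.mem_univ a)
    exact this.trans (le_add_of_nonneg_right zero_le_one)
  refine ⟨C⁻¹, inv_pos.2 hC, fun w hw hw0 => ?_⟩
  obtain ⟨p, rfl⟩ := mem_span_polyRing.1 hw
  have hgw : g (∑ i, polyHom F (p i) • u i) = fun i => polyHom F (p i) :=
    LinearMap.congr_fun hg fun i => polyHom F (p i)
  obtain ⟨i, hi⟩ : ∃ i, p i ≠ 0 := by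
    by_contra! hp
    exact hw0 (by simp [hp])
  have hle := (one_le_absK_polyHom hi).trans ((absK_le_normK _ i).trans
    ((congrArg normK hgw).symm.le.trans (hbound _)))
  rwa [inv_le_iff_one_le_mul₀ hC, mul_comm]

theorem exists_normK_min (h : IsSublattice k Λ) {S : Set (Fin n → F⸨X⸩)} (hS : S.Nonempty)
    (hSΛ : S ⊆ Λ) (h0 : 0 ∉ S) : ∃ w ∈ S, ∀ w' ∈ S, normK w ≤ normK w' := by
  obtain ⟨r, hr, hle⟩ := h.exists_pos_le_normK
  obtain ⟨b, hb, -⟩ := exists_mem_Ico_zpow hr (one_lt_card_real (F := F))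
  have hne : ∀ w ∈ S, w ≠ 0 := fun w hw hw0 => h0 (hw0 ▸ hw)
  obtain ⟨z, ⟨w, hw, hwz⟩, hz⟩ := Int.exists_least_of_bdd
    (P := fun z => ∃ w ∈ S, normK w = (Fintype.card F : ℝ) ^ z)
    ⟨b, fun z ⟨w, hw, hwz⟩ => (zpow_le_zpow_iff_right₀ (one_lt_card_real (F := F))).1
      (hb.trans (hwz ▸ hle w (hSΛ hw) (hne w hw)))⟩
    (let ⟨w, hw⟩ := hS; let ⟨z, hz⟩ := exists_normK_eq_zpow (hne w hw); ⟨z, w, hw, hz⟩)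
  refine ⟨w, hw, fun w' hw' => ?_⟩
  obtain ⟨z', hz'⟩ := exists_normK_eq_zpow (hne w' hw')
  rw [hwz, hz', zpow_le_zpow_iff_right₀ one_lt_card_real]
  exact hz z' ⟨w', hw', hz'⟩

theorem exists_snoc (h : IsSublattice k Λ) (v : Fin j → Fin n → F⸨X⸩) (hj : j < k) :
    ∃ w ∈ Λ, w ∉ Submodule.span F⸨X⸩ (Set.range v) ∧
      ∀ w' ∈ Λ, w' ∉ Submodule.span F⸨X⸩ (Set.range v) → normK w ≤ normK w' := by
  obtain ⟨w₀, hw₀⟩ := h.exists_notMem_span v hj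
  obtain ⟨w, hw, hmin⟩ := h.exists_normK_min
    (S := {w | w ∈ Λ ∧ w ∉ Submodule.span F⸨X⸩ (Set.range v)}) ⟨w₀, hw₀⟩ (fun _ hw => hw.1)
    fun h0 => h0.2 (Submodule.zero_mem _)
  exact ⟨w, hw.1, hw.2, fun w' h1 h2 => hmin w' ⟨h1, h2⟩⟩

theorem exists_isMinSeq (h : IsSublattice k Λ) : ∀ j ≤ k, ∃ v : Fin j → Fin n → F⸨X⸩,
    IsMinSeq Λ v
  | 0, _ => ⟨Fin.elim0, fun i => i.elim0, fun i => i.elim0, fun i => i.elim0⟩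
  | j + 1, hj => by
    obtain ⟨v, hv⟩ := h.exists_isMinSeq j (by omega)
    obtain ⟨w, hw⟩ := h.exists_snoc v hj
    exact ⟨Fin.snoc v w, isMinSeq_snoc.2 ⟨hv, hw⟩⟩

/-- The ordered orthogonal bases are exactly the minimal sequences of full length. -/
theorem mem_orderedOrthogonalBases_iff (h : IsSublattice k Λ) {v : Fin k → Fin n → F⸨X⸩} :
    v ∈ orderedOrthogonalBases k Λ ↔ IsMinSeq Λ v := by
  constructor
  · rintro ⟨⟨-, hspan⟩, ⟨hne, horth⟩, hmono⟩
    have hle : ∀ (c : Fin k → F⸨X⸩) i, absK (c i) * normK (v i) ≤ normK (∑ i, c i • v i) := by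
      intro c i
      rw [horth c, ← normK_smul]
      exact le_ciSup (f := fun i => normK (c i • v i)) (Set.finite_range _).bddAbove i
    have hli : LinearIndependent F⸨X⸩ v := by
      rw [Fintype.linearIndependent_iff]
      intro c hc i
      by_contra hi
      have := hle c i
      rw [hc, normK_zero] at this
      exact this.not_gt (mul_pos (absK_pos hi) (normK_pos (hne i)))
    refine ⟨fun i => hspan ▸ Submodule.subset_span ⟨i, rfl⟩, fun i => ?_, fun i w hw hnot => ?_⟩
    · exact hli.notMem_span_image (lt_irrefl i)
    · rw [hspan] at hw
      obtain ⟨p, rfl⟩ := mem_span_polyRing.1 hw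
      obtain ⟨a, hia, hpa⟩ : ∃ a, i ≤ a ∧ p a ≠ 0 := by
        by_contra! hcon
        refine hnot (Submodule.sum_mem _ fun a _ => ?_)
        obtain ha | ha := lt_or_ge a i
        · exact Submodule.smul_mem _ _ (Submodule.subset_span ⟨a, ha, rfl⟩)
        · simp [hcon a ha]
      refine (hmono hia).trans (le_trans ?_ (hle _ a))
      exact le_mul_of_one_le_left (normK_nonneg _) (one_le_absK_polyHom hpa)
  · intro hv
    have hΛ : ∀ p : F[X], ∀ w ∈ Λ, polyHom F p • w ∈ Λ := fun p w hw => h.polyHom_smul_mem p hw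
    have hli : LinearIndependent (polyRing F) v := by
      rw [Fintype.linearIndependent_iff]
      exact fun c hc i => Subtype.ext
        (Fintype.linearIndependent_iff.1 hv.linearIndependent (fun i => (c i : F⸨X⸩)) hc i)
    refine ⟨⟨hli, ?_⟩, hv.isOrthogonal hΛ, hv.monotone⟩
    ext w
    rw [mem_span_polyRing]
    constructor
    · intro hw
      obtain ⟨c, rfl⟩ := (Submodule.mem_span_range_iff_exists_fun _).1
        (h.mem_span_of_linearIndependent hv.linearIndependent hv.mem hw)
      obtain ⟨p, hp⟩ := hv.exists_polyHom_eq hΛ hw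
      exact ⟨p, by simp [hp]⟩
    · rintro ⟨p, rfl⟩
      exact Λ.sum_mem fun i _ => hΛ _ _ (hv.mem i)

end IsSublattice

end Lattice

/-! ### Counting minimal sequences -/

section Counting

variable {F : Type*} [Field F] [Fintype F] {n j k : ℕ} {Λ : AddSubgroup (Fin n → F⸨X⸩)}

/-- By orthogonality, a vector of `Λ` in the span of a minimal sequence has norm at most `q ^ e`
precisely when its `i`-th coordinate is a polynomial of degree at most `e - d i`; for `e < d i`
this leaves only the zero polynomial. -/
theorem IsMinSeq.finite_ncard_ball (h : IsSublattice k Λ) {v : Fin j → Fin n → F⸨X⸩}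
    (hv : IsMinSeq Λ v) {d : ℕ → ℤ} (hd : ∀ i : Fin j, normK (v i) = (Fintype.card F : ℝ) ^ d i)
    (e : ℤ) :
    {w | w ∈ Λ ∧ w ∈ Submodule.span F⸨X⸩ (Set.range v) ∧
      normK w ≤ (Fintype.card F : ℝ) ^ e}.Finite ∧
    {w | w ∈ Λ ∧ w ∈ Submodule.span F⸨X⸩ (Set.range v) ∧
      normK w ≤ (Fintype.card F : ℝ) ^ e}.ncard =
        ∏ i ∈ Finset.range j, Fintype.card F ^ (e - d i + 1).toNat := by
  have hΛ : ∀ p : F[X], ∀ w ∈ Λ, polyHom F p • w ∈ Λ := fun p w hw => h.polyHom_smul_mem p hw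
  have hsmul : ∀ (p : F[X]) (i : Fin j), normK (polyHom F p • v i) ≤ (Fintype.card F : ℝ) ^ e ↔
      p ∈ Polynomial.degreeLT F (e - d i + 1).toNat := by
    intro p i
    rw [← absK_polyHom_le_iff, normK_smul, hd i, zpow_sub₀ card_real_pos.ne',
      le_div_iff₀ (zpow_pos card_real_pos _)]
  let f : (∀ i : Fin j, Polynomial.degreeLT F (e - d i + 1).toNat) → Fin n → F⸨X⸩ :=
    fun p => ∑ i, polyHom F (p i) • v i
  have hf : Function.Injective f := by
    intro p p' hp
    funext i
    refine Subtype.ext (polyHom_injective (sub_eq_zero.1 ?_))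
    refine Fintype.linearIndependent_iff.1 hv.linearIndependent
      (fun i => polyHom F (p i) - polyHom F (p' i)) ?_ i
    simp only [sub_smul, Finset.sum_sub_distrib]
    exact sub_eq_zero.2 hp
  have hrange : {w | w ∈ Λ ∧ w ∈ Submodule.span F⸨X⸩ (Set.range v) ∧
      normK w ≤ (Fintype.card F : ℝ) ^ e} = Set.range f := by
    ext w
    constructor
    · rintro ⟨hw, hspan, hnorm⟩
      obtain ⟨c, rfl⟩ := (Submodule.mem_span_range_iff_exists_fun _).1 hspan
      obtain ⟨p, hp⟩ := hv.exists_polyHom_eq hΛ hw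
      refine ⟨fun i => ⟨p i, (hsmul _ i).1 ?_⟩, by simp [f, hp]⟩
      rw [← hp]
      exact (hv.normK_smul_le_normK_sum hΛ c i).trans hnorm
    · rintro ⟨p, rfl⟩
      exact ⟨Λ.sum_mem fun i _ => hΛ _ _ (hv.mem i), Submodule.sum_mem _ fun i _ =>
        Submodule.smul_mem _ _ (Submodule.subset_span ⟨i, rfl⟩),
        normK_sum_le _ _ (zpow_pos card_real_pos _).le fun i _ => (hsmul _ i).2 (p i).2⟩
  have : ∀ i : Fin j, Finite (Polynomial.degreeLT F (e - d i + 1).toNat) :=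
    fun i => finite_degreeLT _
  rw [hrange]
  refine ⟨Set.finite_range f, ?_⟩
  rw [← Nat.card_coe_set_eq, Nat.card_range_of_injective hf, Nat.card_pi,
    ← Fin.prod_univ_eq_prod_range (fun i => Fintype.card F ^ (e - d i + 1).toNat)]
  exact Finset.prod_congr rfl fun i _ => natCard_degreeLT _

/-- The vectors that prolong a minimal sequence of length `j` are those of norm at most the next
successive minimum, minus those in the span of the sequence. -/
theorem IsMinSeq.finite_ncard_snoc (h : IsSublattice k Λ) {v : Fin j → Fin n → F⸨X⸩}
    (hv : IsMinSeq Λ v) (hj : j < k) {d : ℕ → ℤ}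
    (hd : ∀ i < k, succMin Λ (i + 1) = (Fintype.card F : ℝ) ^ d i) :
    {w | IsMinSeq Λ (Fin.snoc v w : Fin (j + 1) → Fin n → F⸨X⸩)}.Finite ∧
    {w | IsMinSeq Λ (Fin.snoc v w : Fin (j + 1) → Fin n → F⸨X⸩)}.ncard =
      ∏ i ∈ Finset.range k, Fintype.card F ^ (d j - d i + 1).toNat -
        ∏ i ∈ Finset.range j, Fintype.card F ^ (d j - d i + 1).toNat := by
  obtain ⟨u, hu⟩ := h.exists_isMinSeq k le_rfl
  have hsnoc : ∀ w, IsMinSeq Λ (Fin.snoc v w : Fin (j + 1) → Fin n → F⸨X⸩) →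
      normK w = (Fintype.card F : ℝ) ^ d j := by
    intro w hw
    rw [← hd j hj]
    simpa using (hw.succMin_eq (Fin.last j)).symm
  obtain ⟨hfin, hcard⟩ := hu.finite_ncard_ball h
    (fun i => by rw [← hu.succMin_eq i, hd i i.2]) (d j)
  obtain ⟨hfin', hcard'⟩ := hv.finite_ncard_ball h
    (fun i => by rw [← hv.succMin_eq i, hd i (i.2.trans hj)]) (d j)
  have heq : {w | IsMinSeq Λ (Fin.snoc v w : Fin (j + 1) → Fin n → F⸨X⸩)} =
      {w | w ∈ Λ ∧ w ∈ Submodule.span F⸨X⸩ (Set.range u) ∧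
        normK w ≤ (Fintype.card F : ℝ) ^ d j} \
      {w | w ∈ Λ ∧ w ∈ Submodule.span F⸨X⸩ (Set.range v) ∧
        normK w ≤ (Fintype.card F : ℝ) ^ d j} := by
    ext w
    constructor
    · intro hw
      have hw' := isMinSeq_snoc.1 hw
      exact ⟨⟨hw'.2.1, h.mem_span_of_linearIndependent hu.linearIndependent hu.mem hw'.2.1,
        (hsnoc w hw).le⟩, fun hcon => hw'.2.2.1 hcon.2.1⟩
    · rintro ⟨⟨hw, -, hle⟩, hnot⟩
      obtain ⟨w₀, hw₀⟩ := h.exists_snoc v hj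
      refine isMinSeq_snoc.2 ⟨hv, hw, fun hcon => hnot ⟨hw, hcon, hle⟩, fun w' h1 h2 => ?_⟩
      rw [← hsnoc w₀ (isMinSeq_snoc.2 ⟨hv, hw₀⟩)] at hle
      exact hle.trans (hw₀.2.2 w' h1 h2)
  rw [heq, ← hcard, ← hcard']
  exact ⟨hfin.sdiff, Set.ncard_sdiff (fun w hw => ⟨hw.1,
    h.mem_span_of_linearIndependent hu.linearIndependent hu.mem hw.1, hw.2.2⟩) hfin'⟩

/-- The number of prolongations of a minimal sequence depends only on its length, so the counts
multiply. -/
theorem IsSublattice.finite_natCard_isMinSeq (h : IsSublattice k Λ) {d : ℕ → ℤ}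
    (hd : ∀ i < k, succMin Λ (i + 1) = (Fintype.card F : ℝ) ^ d i) : ∀ j ≤ k,
    Finite {v : Fin j → Fin n → F⸨X⸩ // IsMinSeq Λ v} ∧
    Nat.card {v : Fin j → Fin n → F⸨X⸩ // IsMinSeq Λ v} =
      ∏ l ∈ Finset.range j, (∏ i ∈ Finset.range k, Fintype.card F ^ (d l - d i + 1).toNat -
        ∏ i ∈ Finset.range l, Fintype.card F ^ (d l - d i + 1).toNat)
  | 0, _ => by
    have : Unique {v : Fin 0 → Fin n → F⸨X⸩ // IsMinSeq Λ v} :=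
      ⟨⟨⟨Fin.elim0, fun i => i.elim0, fun i => i.elim0, fun i => i.elim0⟩⟩,
        fun a => Subsingleton.elim _ _⟩
    exact ⟨inferInstance, by simp⟩
  | j + 1, hj => by
    obtain ⟨hfin, hcard⟩ := h.finite_natCard_isMinSeq hd j (by omega)
    let f : (Σ v : {v : Fin j → Fin n → F⸨X⸩ // IsMinSeq Λ v},
        {w | IsMinSeq Λ (Fin.snoc v.1 w : Fin (j + 1) → Fin n → F⸨X⸩)}) →
        {v : Fin (j + 1) → Fin n → F⸨X⸩ // IsMinSeq Λ v} :=
      fun p => ⟨Fin.snoc p.1.1 p.2.1, p.2.2⟩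
    have hf : Function.Bijective f := by
      constructor
      · rintro ⟨⟨v, hv⟩, ⟨w, hw⟩⟩ ⟨⟨v', hv'⟩, ⟨w', hw'⟩⟩ heq
        obtain ⟨rfl, rfl⟩ := Fin.snoc_injective2 (α := fun _ => Fin n → F⸨X⸩)
          (Subtype.ext_iff.1 heq)
        rfl
      · rintro ⟨v, hv⟩
        rw [← Fin.snoc_init_self v] at hv
        exact ⟨⟨⟨Fin.init v, (isMinSeq_snoc.1 hv).1⟩, ⟨v (Fin.last j), hv⟩⟩,
          Subtype.ext (Fin.snoc_init_self v)⟩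
    have hfib : ∀ v : {v : Fin j → Fin n → F⸨X⸩ // IsMinSeq Λ v},
        Finite {w | IsMinSeq Λ (Fin.snoc v.1 w : Fin (j + 1) → Fin n → F⸨X⸩)} :=
      fun v => (v.2.finite_ncard_snoc h hj hd).1
    refine ⟨Finite.of_surjective f hf.2, ?_⟩
    have := Fintype.ofFinite {v : Fin j → Fin n → F⸨X⸩ // IsMinSeq Λ v}
    rw [← Nat.card_congr (Equiv.ofBijective f hf), Nat.card_sigma, Finset.prod_range_succ, ← hcard]
    rw [Finset.sum_congr rfl fun v _ => (Nat.card_coe_set_eq _).trans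
      (v.2.finite_ncard_snoc h hj hd).2]
    simp

end Counting

/-! ### Evaluating the product -/

section Product

/-- The elements of a finite set `t` of a linear order have `0, 1, …, #t - 1` predecessors. -/
theorem prod_card_filter_lt {α M : Type*} [LinearOrder α] [CommMonoid M] (t : Finset α)
    (g : ℕ → M) : ∏ i ∈ t, g {a ∈ t | a < i}.card = ∏ i ∈ Finset.range t.card, g i := by
  induction t using Finset.induction_on_max with
  | empty => simp
  | insert b t hb ih =>
    have hbt : b ∉ t := fun h => (hb b h).false
    rw [Finset.prod_insert hbt, Finset.card_insert_of_notMem hbt, Finset.prod_range_succ, mul_comm,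
      ← ih]
    congr 1
    · refine Finset.prod_congr rfl fun i hi => ?_
      rw [Finset.filter_insert, if_neg (hb i hi).not_gt]
    · rw [Finset.filter_insert, if_neg (lt_irrefl b), Finset.filter_true_of_mem hb]

theorem prod_zpow_eq_zpow_sum {ι K : Type*} [CommGroupWithZero K] {q : K} (hq : q ≠ 0)
    (t : Finset ι) (f : ι → ℤ) : ∏ i ∈ t, q ^ f i = q ^ ∑ i ∈ t, f i := by
  classical
  induction t using Finset.induction_on with
  | empty => simp
  | insert a t ha ih => rw [Finset.prod_insert ha, Finset.sum_insert ha, zpow_add₀ hq, ih]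

/-- Grouping the indices by the value of `d`: the choices at an index of the `l`-th group with `t`
predecessors in that group number `A l * (q ^ s l - q ^ t)`, where the factor `A l` accounts for
the coordinates from the earlier groups. -/
theorem prod_sub_prod_eq {q : ℝ} (hq : q ≠ 0) {k m : ℕ} (hk : 0 < k) {d : ℕ → ℤ} {e : Fin m → ℤ}
    {s : Fin m → ℕ} (hd : ∀ i j, i ≤ j → j < k → d i ≤ d j) (he : StrictMono e)
    (hde : ∀ i < k, ∃ l, d i = e l) (hs : ∀ l, {i ∈ Finset.range k | d i = e l}.card = s l) :
    ∏ l ∈ Finset.range k, (∏ i ∈ Finset.range k, q ^ (d l - d i + 1).toNat -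
        ∏ i ∈ Finset.range l, q ^ (d l - d i + 1).toNat) =
      q ^ (∑ l, s l * ∑ j ∈ Finset.Iio l, s j) *
        ∏ l, ((q ^ e l) ^ ((s l : ℤ) *
              ((∑ i ∈ Finset.Iio l, (s i : ℤ)) - ∑ i ∈ Finset.Ioi l, (s i : ℤ))) *
            ∏ i ∈ Finset.range (s l), (q ^ s l - q ^ i)) := by
  have : Nonempty (Fin m) := ⟨(hde 0 hk).choose⟩
  have hmaps : ∀ i ∈ Finset.range k, ∃ l, d i = e l := fun i hi => hde i (Finset.mem_range.1 hi)
  choose! c hc using hmaps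
  have hceq : ∀ i ∈ Finset.range k, ∀ l, c i = l ↔ d i = e l := fun i hi l =>
    ⟨fun h => h ▸ hc i hi, fun h => he.injective ((hc i hi).symm.trans h)⟩
  have hfib : ∀ l, {i ∈ Finset.range k | c i = l} = {i ∈ Finset.range k | d i = e l} := fun l =>
    Finset.filter_congr fun i hi => hceq i hi l
  -- `s j` earlier coordinates with exponent `e j` each range over polynomials of degree at most
  -- `e l - e j`
  set A : Fin m → ℝ := fun l => ∏ j ∈ Finset.Iio l, (q ^ (e l - e j + 1)) ^ s j with hA
  have hAeq : ∀ l, ∏ i ∈ Finset.range k with d i < e l, q ^ (e l - d i + 1).toNat = A l := by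
    intro l
    rw [hA, ← Finset.prod_fiberwise_of_maps_to (g := c) (t := Finset.Iio l)]
    · refine Finset.prod_congr rfl fun j hj => ?_
      have hj' := he (Finset.mem_Iio.1 hj)
      rw [← hs j, ← Finset.prod_const, ← hfib, Finset.filter_filter]
      have : {i ∈ Finset.range k | d i < e l ∧ c i = j} = {i ∈ Finset.range k | c i = j} :=
        Finset.filter_congr fun i hi => by rw [hceq i hi]; constructor <;> intro h <;> omega
      rw [this]
      refine Finset.prod_congr rfl fun i hi => ?_
      obtain ⟨hik, hij⟩ := Finset.mem_filter.1 hi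
      rw [(hceq i hik j).1 hij, ← zpow_natCast, Int.toNat_of_nonneg (by omega)]
    · intro i hi
      obtain ⟨hik, hlt⟩ := Finset.mem_filter.1 hi
      rw [hc i hik] at hlt
      exact Finset.mem_Iio.2 (he.lt_iff_lt.1 hlt)
  -- an initial segment that contains the earlier groups: each index of the `l`-th group adds one
  -- factor `q`, and the later groups add none, as the truncated exponent vanishes
  have hsplit : ∀ l, ∀ r ≤ k, (∀ i < k, d i < e l → i < r) →
      ∏ i ∈ Finset.range r, q ^ (e l - d i + 1).toNat =
        A l * q ^ {i ∈ Finset.range r | d i = e l}.card := by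
    intro l r hr hall
    rw [← Finset.prod_filter_mul_prod_filter_not _ (fun i => d i < e l), ← hAeq]
    congr 1
    · refine Finset.prod_congr (Finset.ext fun i => ?_) fun _ _ => rfl
      simp only [Finset.mem_filter, Finset.mem_range]
      exact ⟨fun h => ⟨h.1.trans_le hr, h.2⟩, fun h => ⟨hall i h.1 h.2, h.2⟩⟩
    · rw [← Finset.prod_const, Finset.prod_filter, Finset.prod_filter]
      refine Finset.prod_congr rfl fun i _ => ?_
      obtain h | h | h := lt_trichotomy (d i) (e l)
      · simp [h, h.ne]
      · simp [h]
      · rw [if_pos h.not_gt, if_neg h.ne', Int.toNat_of_nonpos (by omega), pow_zero]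
  rw [← Finset.prod_fiberwise_of_maps_to (g := c) (t := Finset.univ) (by simp)]
  have hgroup : ∀ l, ∏ i ∈ Finset.range k with c i = l,
      (∏ i' ∈ Finset.range k, q ^ (d i - d i' + 1).toNat -
        ∏ i' ∈ Finset.range i, q ^ (d i - d i' + 1).toNat) =
      A l ^ s l * ∏ i ∈ Finset.range (s l), (q ^ s l - q ^ i) := by
    intro l
    rw [hfib, ← hs l, ← prod_card_filter_lt _ fun t => q ^ _ - q ^ t, ← Finset.prod_const,
      ← Finset.prod_mul_distrib]
    refine Finset.prod_congr rfl fun i hi => ?_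
    obtain ⟨hik, hil⟩ := Finset.mem_filter.1 hi
    rw [Finset.mem_range] at hik
    rw [hil, hsplit l k le_rfl (fun i hi _ => hi), hsplit l i hik.le fun i' hi' hlt => ?_, mul_sub]
    · congr 4
      ext a
      simp only [Finset.mem_filter, Finset.mem_range]
      exact ⟨fun h => ⟨⟨h.1.trans hik, h.2⟩, h.1⟩, fun h => ⟨h.2, h.1.2⟩⟩
    · by_contra! hle
      have := hd i i' hle hi'
      omega
  rw [Finset.prod_congr rfl fun l _ => hgroup l, Finset.prod_mul_distrib, Finset.prod_mul_distrib,
    ← mul_assoc]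
  congr 1
  have hlhs : ∀ l, A l ^ s l = q ^ ∑ j ∈ Finset.Iio l, (e l - e j + 1) * s j * s l := by
    intro l
    rw [hA, ← prod_zpow_eq_zpow_sum hq, ← Finset.prod_pow]
    exact Finset.prod_congr rfl fun j _ => by simp only [zpow_mul, zpow_natCast]
  rw [Finset.prod_congr rfl fun l _ => hlhs l, prod_zpow_eq_zpow_sum hq,
    Finset.prod_congr rfl fun l _ => (zpow_mul q _ _).symm, prod_zpow_eq_zpow_sum hq,
    ← zpow_natCast q, ← zpow_add₀ hq]
  congr 1
  have hswap : ∑ l, ∑ j ∈ Finset.Iio l, e j * s j * s l =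
      ∑ l, ∑ j ∈ Finset.Ioi l, e l * s l * s j :=
    Finset.sum_comm' (by simp)
  push_cast
  simp only [add_mul, sub_mul, one_mul, mul_sub, Finset.sum_add_distrib, Finset.sum_sub_distrib,
    hswap, Finset.mul_sum]
  rw [add_comm]
  simp only [mul_assoc, mul_comm, mul_left_comm]

end Product

end FunctionFieldLattice

/-! ### The number of ordered orthogonal bases -/

theorem mainTheorem5 {F : Type*} [Field F] [Fintype F] (q : ℕ) (hq : Fintype.card F = q)
    {n k m : ℕ} (hk : 1 ≤ k) (hkn : k ≤ n) (μ : Fin m → ℝ) (s : Fin m → ℕ)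
    (Λ : AddSubgroup (Fin n → LaurentSeries F))
    (hΛ : FunctionFieldLattice.IsMuSSublattice k μ s Λ) :
    (FunctionFieldLattice.orderedOrthogonalBases k Λ).Finite ∧
    ((FunctionFieldLattice.orderedOrthogonalBases k Λ).ncard : ℝ) =
      if m = 1 then ∏ i ∈ Finset.range k, ((q : ℝ) ^ k - (q : ℝ) ^ i)
      else
        (q : ℝ) ^ (∑ l, s l * ∑ j ∈ Finset.Iio l, s j) *
          ∏ l, (μ l ^ ((s l : ℤ) *
                ((∑ i ∈ Finset.Iio l, (s i : ℤ)) - ∑ i ∈ Finset.Ioi l, (s i : ℤ))) *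
              ∏ i ∈ Finset.range (s l), ((q : ℝ) ^ s l - (q : ℝ) ^ i)) := by
  open FunctionFieldLattice in
  subst hq
  have h := hΛ.isSublattice
  have hq1 : (1 : ℝ) < Fintype.card F := one_lt_card_real
  have hq0 : (Fintype.card F : ℝ) ≠ 0 := card_real_pos.ne'
  choose e he using hΛ.mem_zpow
  obtain rfl : μ = fun l => (Fintype.card F : ℝ) ^ e l := funext he
  have hmono : StrictMono e := fun a b hab =>
    (zpow_lt_zpow_iff_right₀ hq1).1 (hΛ.strictMono hab)
  obtain ⟨u, hu⟩ := h.exists_isMinSeq k le_rfl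
  have hex : ∀ i : ℕ, ∃ z : ℤ, i < k → succMin Λ (i + 1) = (Fintype.card F : ℝ) ^ z := by
    intro i
    by_cases hi : i < k
    · obtain ⟨z, hz⟩ := exists_normK_eq_zpow (hu.ne_zero ⟨i, hi⟩)
      exact ⟨z, fun _ => (hu.succMin_eq ⟨i, hi⟩).trans hz⟩
    · exact ⟨0, fun h => (hi h).elim⟩
  choose d hd using hex
  have hd_mono : ∀ i j, i ≤ j → j < k → d i ≤ d j := by
    intro i j hij hj
    rw [← zpow_le_zpow_iff_right₀ hq1, ← hd i (hij.trans_lt hj), ← hd j hj]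
    exact (hu.succMin_eq ⟨i, hij.trans_lt hj⟩).le.trans
      ((hu.monotone (Fin.mk_le_mk.2 hij)).trans (hu.succMin_eq ⟨j, hj⟩).ge)
  have hde_iff : ∀ i < k, ∀ l, succMin Λ (i + 1) = (Fintype.card F : ℝ) ^ e l ↔ d i = e l := by
    intro i hi l
    rw [hd i hi, zpow_right_inj₀ card_real_pos hq1.ne']
  have hde : ∀ i < k, ∃ l, d i = e l := by
    intro i hi
    have hmem : succMin Λ (i + 1) ∈ succMin Λ '' Set.Icc 1 k :=
      ⟨i + 1, ⟨by omega, by omega⟩, rfl⟩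
    rw [hΛ.minima_eq] at hmem
    obtain ⟨l, hl⟩ := hmem
    exact ⟨l, (hde_iff i hi l).1 hl.symm⟩
  have hs : ∀ l, {i ∈ Finset.range k | d i = e l}.card = s l := by
    intro l
    rw [← hΛ.mult_eq l, ← Set.ncard_coe_finset,
      ← Set.ncard_image_of_injective _ (add_left_injective 1)]
    congr 1
    ext i
    simp only [Set.mem_image, Finset.coe_filter, Finset.mem_range, Set.mem_ofPred_eq, Set.mem_Icc]
    constructor
    · rintro ⟨a, ⟨ha, hal⟩, rfl⟩
      exact ⟨⟨by omega, by omega⟩, (hde_iff a ha l).2 hal⟩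
    · rintro ⟨⟨h1, hik⟩, hil⟩
      obtain ⟨a, rfl⟩ : ∃ a, i = a + 1 := ⟨i - 1, by omega⟩
      exact ⟨a, ⟨by omega, (hde_iff a (by omega) l).1 hil⟩, rfl⟩
  have hset : orderedOrthogonalBases k Λ = {v | IsMinSeq Λ v} :=
    Set.ext fun v => h.mem_orderedOrthogonalBases_iff
  obtain ⟨hfin, hcard⟩ := h.finite_natCard_isMinSeq hd k le_rfl
  refine ⟨hset ▸ hfin, ?_⟩
  have hcard' : ((orderedOrthogonalBases k Λ).ncard : ℝ) =
      ∏ l ∈ Finset.range k, (∏ i ∈ Finset.range k, (Fintype.card F : ℝ) ^ (d l - d i + 1).toNat -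
        ∏ i ∈ Finset.range l, (Fintype.card F : ℝ) ^ (d l - d i + 1).toNat) := by
    rw [hset, ← Nat.card_coe_set_eq, Set.coe_ofPred, hcard, Nat.cast_prod]
    refine Finset.prod_congr rfl fun l hl => ?_
    rw [Nat.cast_sub]
    · push_cast
      rfl
    · exact Finset.prod_le_prod_of_subset_of_one_le' (by simpa using (Finset.mem_range.1 hl).le)
        fun _ _ _ => Nat.one_le_pow _ _ Fintype.card_pos
  rw [hcard', prod_sub_prod_eq hq0 hk hd_mono hmono hde hs]
  split_ifs with hm
  · -- a single group: its size is `k`, and no power of `μ` or extra power of `q` occurs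
    subst hm
    have hsk : s 0 = k := by
      rw [← hs 0, Finset.filter_true_of_mem, Finset.card_range]
      intro i hi
      obtain ⟨l, hl⟩ := hde i (Finset.mem_range.1 hi)
      rwa [Subsingleton.elim l 0] at hl
    have hIio : Finset.Iio (0 : Fin 1) = ∅ := by decide
    simp [hsk, hIio]
  · rfl
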